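/- Let $\Bbbk$ be a field of characteristic zero and let $\Omega$ be a set. An $\Omega$-algebra is a $\Bbbk$-linear space with bilinear operations $\circ_\omega$, $\omega\in\Omega$; the variety $\mathrm{Var}(B)$ generated by an $\Omega$-algebra $B$ is the class of all $\Omega$-algebras satisfying every polynomial identity of $B$ (nonassociative polynomials over $\Bbbk$ in the operations $\circ_\omega$). Let $A$ be a $\Bbbk$-linear space with bilinear operations $\vdash_\omega,\dashv_\omega$, $\omega\in\Omega$, belonging to the variety $\mathrm{di}$-$\mathrm{Alg}_0$, that is, satisfying \[ (x\vdash_\omega y-x\dashv_\omega y)\vdash_\mu z=0,\qquad x\dashv_\mu(y\vdash_\omega z-y\dashv_\omega z)=0\qquad(\omega,\mu\in\Omega). \] Let $\bar A=A/\mathrm{span}\{a\vdash_\omega b-a\dashv_\omega b\mid a,b\in A,\ \omega\in\Omega\}$, with the operations $\bar a\circ_\omega\bar b=\overline{a\vdash_\omega b}=\overline{a\dashv_\omega b}$, and let $\hat A=\bar A\ltimes A$ be the $\Omega$-algebra on the space $\bar A\oplus A$ that contains $\bar A$ as a subalgebra and in which \[ \bar a\circ_\omega b=a\vdash_\omega b,\qquad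 a\circ_\omega\bar b=a\dashv_\omega b,\qquad a\circ_\omega b=0\qquad(a,b\in A). \] Let $m\ge 1$ and let $Z=\mathrm{pre}\text{-}\mathrm{Com}\langle z_1,\dots,z_m\rangle$ be the free pre-commutative (Zinbiel) algebra on $m$ generators, i.e. the free algebra with one bilinear product satisfying $(xy+yx)z=x(yz)$. Let $Z\boxtimes A$ be the space $Z\otimes A$ with the operations \[ (z\otimes a)\circ_\omega(w\otimes b)=zw\otimes(a\vdash_\omega b)+wz\otimes(a\dashv_\omega b)\qquad(z,w\in Z,\ a,b\in A). \] Then \[ \mathrm{Var}(Z\boxtimes A)=\mathrm{Var}(\hat A). \] -/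

import Mathlib

open scoped TensorProduct

universe u v w t

noncomputable section

/-- A (not necessarily associative) algebra over `k` with a family of bilinear operations
`∘_ω`, `ω ∈ Ω`. -/
structure OmegaAlgebra (k : Type u) [Field k] (Ω : Type v) : Type (max u v (w + 1)) where
  carrier : Type w
  [addCommGroup : AddCommGroup carrier]
  [module : Module k carrier]
  op : Ω → carrier →ₗ[k] carrier →ₗ[k] carrier

attribute [instance] OmegaAlgebra.addCommGroup OmegaAlgebra.module

/-- A linear space over `k` with a doubled family of bilinear operations:
`left ω a b` is `a ⊢_ω b` and `right ω a b` is `a ⊣_ω b`. -/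
structure OmegaDialgebra (k : Type u) [Field k] (Ω : Type v) : Type (max u v (w + 1)) where
  carrier : Type w
  [addCommGroup : AddCommGroup carrier]
  [module : Module k carrier]
  left : Ω → carrier →ₗ[k] carrier →ₗ[k] carrier
  right : Ω → carrier →ₗ[k] carrier →ₗ[k] carrier

attribute [instance] OmegaDialgebra.addCommGroup OmegaDialgebra.module

/-! ### Identities and varieties -/

/-- Nonassociative monomials in variables `X` with operation symbols `Ω`. -/
inductive OmegaMonomial (Ω : Type v) (X : Type w) : Type (max v w)
  | var (x : X) : OmegaMonomial Ω X
  | op (ω : Ω) (s t : OmegaMonomial Ω X) : OmegaMonomial Ω X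

/-- Elements of the free `Ω`-algebra on `x₀, x₁, …`: nonassociative polynomials, i.e. linear
combinations of nonassociative monomials. -/
abbrev OmegaPolynomial (k : Type u) [Field k] (Ω : Type v) : Type (max u v) :=
  OmegaMonomial Ω ℕ →₀ k

namespace OmegaAlgebra

variable {k : Type u} [Field k] {Ω : Type v}

/-- Value of a monomial in `B` under a substitution of the variables. -/
def evalMonomial (B : OmegaAlgebra.{u, v, w} k Ω) (x : ℕ → B.carrier) :
    OmegaMonomial Ω ℕ → B.carrier
  | .var i => x i
  | .op ω s t => B.op ω (B.evalMonomial x s) (B.evalMonomial x t)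

/-- Value of a polynomial in `B` under a substitution of the variables. -/
def eval (B : OmegaAlgebra.{u, v, w} k Ω) (x : ℕ → B.carrier) :
    OmegaPolynomial k Ω →ₗ[k] B.carrier :=
  Finsupp.linearCombination k (B.evalMonomial x)

/-- `f = 0` is an identity on `B`. -/
def Satisfies (B : OmegaAlgebra.{u, v, w} k Ω) (f : OmegaPolynomial k Ω) : Prop :=
  ∀ x : ℕ → B.carrier, B.eval x f = 0

/-- The variety generated by `B`: the class of all `Ω`-algebras (in an arbitrary universe) on
which every identity of `B` holds. -/
def Var (B : OmegaAlgebra.{u, v, w} k Ω) : Set (OmegaAlgebra.{u, v, t} k Ω) :=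
  {C | ∀ f : OmegaPolynomial k Ω, B.Satisfies f → C.Satisfies f}

/-- The split null extension `A ⋉ M`: the space `A ⊕ M` where `A` is a subalgebra, `A` acts on `M`
by `a ∘_ω u = l ω a u` and `u ∘_ω a = r ω u a`, and `M ∘_ω M = 0`. -/
def splitNullExtension (A : OmegaAlgebra.{u, v, w} k Ω)
    (M : Type t) [AddCommGroup M] [Module k M]
    (l : Ω → A.carrier →ₗ[k] M →ₗ[k] M) (r : Ω → M →ₗ[k] A.carrier →ₗ[k] M) :
    OmegaAlgebra.{u, v, max w t} k Ω where
  carrier := A.carrier × M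
  op ω :=
    ((A.op ω).compl₁₂ (LinearMap.fst k A.carrier M) (LinearMap.fst k A.carrier M)).compr₂
        (LinearMap.inl k A.carrier M)
      + ((l ω).compl₁₂ (LinearMap.fst k A.carrier M) (LinearMap.snd k A.carrier M)).compr₂
        (LinearMap.inr k A.carrier M)
      + ((r ω).compl₁₂ (LinearMap.snd k A.carrier M) (LinearMap.fst k A.carrier M)).compr₂
        (LinearMap.inr k A.carrier M)

end OmegaAlgebra

/-- A bilinear operation on `M` for which `I` is a two-sided ideal induces one on `M ⧸ I`. -/
def quotientOp {k : Type u} [Field k] {M : Type w} [AddCommGroup M] [Module k M]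
    (I : Submodule k M) (B : M →ₗ[k] M →ₗ[k] M)
    (h₁ : ∀ x ∈ I, ∀ y, B x y ∈ I) (h₂ : ∀ x, ∀ y ∈ I, B x y ∈ I) :
    (M ⧸ I) →ₗ[k] (M ⧸ I) →ₗ[k] (M ⧸ I) :=
  (I.liftQ (I.liftQ (B.compr₂ I.mkQ) (fun x hx => by
      rw [LinearMap.mem_ker]
      ext y
      simpa using h₁ x hx y)).flip (fun y hy => by
    rw [LinearMap.mem_ker]
    ext x
    simpa using h₂ x y hy)).flip

/-! ### Dialgebras of the variety di-Alg₀ and the algebra `Â` -/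

namespace OmegaDialgebra

variable {k : Type u} [Field k] {Ω : Type v}

/-- Membership in the variety di-Alg₀:
`(x ⊢_ω y - x ⊣_ω y) ⊢_μ z = 0` and `x ⊣_μ (y ⊢_ω z - y ⊣_ω z) = 0`. -/
structure IsDiAlg₀ (D : OmegaDialgebra.{u, v, w} k Ω) : Prop where
  left_identity : ∀ (ω μ : Ω) (x y z : D.carrier),
    D.left μ (D.left ω x y - D.right ω x y) z = 0
  right_identity : ∀ (ω μ : Ω) (x y z : D.carrier),
    D.right μ x (D.left ω y z - D.right ω y z) = 0

/-- The span of all `a ⊢_ω b - a ⊣_ω b`. -/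
def differenceSpan (D : OmegaDialgebra.{u, v, w} k Ω) : Submodule k D.carrier :=
  Submodule.span k {d | ∃ (ω : Ω) (a b : D.carrier), d = D.left ω a b - D.right ω a b}

variable {D : OmegaDialgebra.{u, v, w} k Ω}

theorem IsDiAlg₀.left_eq_zero (hD : D.IsDiAlg₀) (μ : Ω) {d : D.carrier}
    (hd : d ∈ D.differenceSpan) : D.left μ d = 0 := by
  have h : D.differenceSpan ≤ LinearMap.ker (D.left μ) := by
    refine Submodule.span_le.2 ?_
    rintro _ ⟨ω, a, b, rfl⟩
    exact LinearMap.mem_ker.2 (LinearMap.ext fun z => hD.left_identity ω μ a b z)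
  exact h hd

theorem IsDiAlg₀.right_eq_zero (hD : D.IsDiAlg₀) (μ : Ω) {d : D.carrier}
    (hd : d ∈ D.differenceSpan) : (D.right μ).flip d = 0 := by
  have h : D.differenceSpan ≤ LinearMap.ker (D.right μ).flip := by
    refine Submodule.span_le.2 ?_
    rintro _ ⟨ω, a, b, rfl⟩
    exact LinearMap.mem_ker.2 (LinearMap.ext fun z => hD.right_identity ω μ z a b)
  exact h hd

theorem IsDiAlg₀.left_mem (hD : D.IsDiAlg₀) (μ : Ω) (x : D.carrier) {d : D.carrier}
    (hd : d ∈ D.differenceSpan) : D.left μ x d ∈ D.differenceSpan := by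
  have h : D.left μ x d - D.right μ x d ∈ D.differenceSpan :=
    Submodule.subset_span ⟨μ, x, d, rfl⟩
  have h0 : D.right μ x d = 0 := LinearMap.congr_fun (hD.right_eq_zero μ hd) x
  rwa [h0, sub_zero] at h

/-- The algebra `D̄ = D / span (a ⊢_ω b - a ⊣_ω b)`, on which `⊢_ω` and `⊣_ω` induce one and the
same operation `∘_ω`. -/
def bar (D : OmegaDialgebra.{u, v, w} k Ω) (hD : D.IsDiAlg₀) : OmegaAlgebra.{u, v, w} k Ω where
  carrier := D.carrier ⧸ D.differenceSpan
  op ω := quotientOp D.differenceSpan (D.left ω)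
    (fun x hx y => by rw [hD.left_eq_zero ω hx]; exact Submodule.zero_mem _)
    (fun x _ hy => hD.left_mem ω x hy)

/-- The left action `ā ∘_ω b = a ⊢_ω b` of `D̄` on `D`. -/
def barLeft (D : OmegaDialgebra.{u, v, w} k Ω) (hD : D.IsDiAlg₀) (ω : Ω) :
    (D.bar hD).carrier →ₗ[k] D.carrier →ₗ[k] D.carrier :=
  D.differenceSpan.liftQ (D.left ω) (fun _ hd => LinearMap.mem_ker.2 (hD.left_eq_zero ω hd))

/-- The right action `a ∘_ω b̄ = a ⊣_ω b` of `D̄` on `D`. -/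
def barRight (D : OmegaDialgebra.{u, v, w} k Ω) (hD : D.IsDiAlg₀) (ω : Ω) :
    D.carrier →ₗ[k] (D.bar hD).carrier →ₗ[k] D.carrier :=
  LinearMap.flip (D.differenceSpan.liftQ (D.right ω).flip
    (fun _ hd => LinearMap.mem_ker.2 (hD.right_eq_zero ω hd)))

/-- The algebra `D̂ = D̄ ⋉ D`. -/
def hat (D : OmegaDialgebra.{u, v, w} k Ω) (hD : D.IsDiAlg₀) : OmegaAlgebra.{u, v, w} k Ω :=
  (D.bar hD).splitNullExtension D.carrier (D.barLeft hD) (D.barRight hD)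

end OmegaDialgebra

/-! ### Free pre-commutative (Zinbiel) algebras -/

/-- The smallest two-sided ideal of the free nonassociative algebra on `X` that contains all
`(xy + yx)z - x(yz)`. -/
def zinbielIdeal (k : Type u) [Field k] (X : Type w) :
    Submodule k (FreeNonUnitalNonAssocAlgebra k X) :=
  sInf {I | (∀ x y z : FreeNonUnitalNonAssocAlgebra k X, (x * y + y * x) * z - x * (y * z) ∈ I) ∧
    (∀ x ∈ I, ∀ y, x * y ∈ I) ∧ (∀ x, ∀ y ∈ I, x * y ∈ I)}

/-- The free pre-commutative algebra on `X`, i.e. the free algebra with one bilinear product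
satisfying `(xy + yx)z = x(yz)`. -/
abbrev FreeZinbiel (k : Type u) [Field k] (X : Type w) : Type (max u w) :=
  FreeNonUnitalNonAssocAlgebra k X ⧸ zinbielIdeal k X

/-- The product of the free pre-commutative algebra. -/
def FreeZinbiel.product (k : Type u) [Field k] (X : Type w) :
    FreeZinbiel k X →ₗ[k] FreeZinbiel k X →ₗ[k] FreeZinbiel k X :=
  quotientOp (zinbielIdeal k X) (LinearMap.mul k (FreeNonUnitalNonAssocAlgebra k X))
    (fun x hx y => (Submodule.mem_sInf).2 fun I hI =>
      hI.2.1 x ((Submodule.mem_sInf).1 hx I hI) y)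
    (fun x y hy => (Submodule.mem_sInf).2 fun I hI =>
      hI.2.2 x y ((Submodule.mem_sInf).1 hy I hI))

/-- For a linear space `Z` with a bilinear product, the space `Z ⊗ D` with the operations
`(z ⊗ a) ∘_ω (w ⊗ b) = zw ⊗ (a ⊢_ω b) + wz ⊗ (a ⊣_ω b)`. -/
def boxTimes {k : Type u} [Field k] {Ω : Type v} {Z : Type t} [AddCommGroup Z] [Module k Z]
    (product : Z →ₗ[k] Z →ₗ[k] Z) (D : OmegaDialgebra.{u, v, w} k Ω) :
    OmegaAlgebra.{u, v, max w t} k Ω where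
  carrier := Z ⊗[k] D.carrier
  op ω := TensorProduct.map₂ product (D.left ω) + TensorProduct.map₂ product.flip (D.right ω)

end

open Polynomial

noncomputable section

/-! Identities pass to subalgebras and to homomorphic images, and, over an infinite field, to
commutative extensions of scalars. So it is enough to embed `Z ⊠ A` in a scalar extension of `Â`,
and to map `Z ⊠ A` onto `Â`.

Embedding: the symmetrised product `xy + yx` of a Zinbiel algebra is commutative and associative,
and `Z` is a module over it by left multiplication. The split null extension `Z ⊕ Z`, with a unit
adjoined, is thus a commutative ring `R`, and `z ⊗ a ↦ (z, 0) ⊗ ā + (0, z) ⊗ a` is an injective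
homomorphism into `R ⊗ Â` (`boxTimesEmbedding_isHom`).

Surjection: polynomials with `f ⋆ g = (∫ f) g` form a Zinbiel algebra by integration by parts, so
`Z` maps to it with every generator going to `1`. If `z` goes to `f` and `F = ∫ f`, the map `z ⊗ a ↦
F(1) ā + f(1) a` is a homomorphism onto `Â` (`boxTimesProjection_isHom`,
`boxTimesProjection_surjective`). -/

/-- A linear map on a tensor product respects bilinear operations if it does so on pure
tensors. -/
theorem TensorProduct.map_op_of_tmul {k : Type*} [CommRing k] {M N P : Type*} [AddCommGroup M]
    [Module k M] [AddCommGroup N] [Module k N] [AddCommGroup P] [Module k P]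
    (F : M ⊗[k] N →ₗ[k] M ⊗[k] N →ₗ[k] M ⊗[k] N) (G : P →ₗ[k] P →ₗ[k] P) (φ : M ⊗[k] N →ₗ[k] P)
    (h : ∀ (p q : M) (a b : N), φ (F (p ⊗ₜ a) (q ⊗ₜ b)) = G (φ (p ⊗ₜ a)) (φ (q ⊗ₜ b)))
    (x y : M ⊗[k] N) : φ (F x y) = G (φ x) (φ y) := by
  induction x using TensorProduct.induction_on with
  | zero => simp
  | add x x' hx hx' => simp only [map_add, LinearMap.add_apply, hx, hx']
  | tmul p a =>
    induction y using TensorProduct.induction_on with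
    | zero => simp
    | add y y' hy hy' => simp only [map_add, hy, hy']
    | tmul q b => exact h p q a b

/-! ### Homomorphisms of `Ω`-algebras and identities -/

namespace OmegaAlgebra

universe s

variable {k : Type u} [Field k] {Ω : Type v}

/-- A linear map that respects all operations. -/
def IsHom (B : OmegaAlgebra.{u, v, w} k Ω) (C : OmegaAlgebra.{u, v, s} k Ω)
    (φ : B.carrier →ₗ[k] C.carrier) : Prop :=
  ∀ (ω : Ω) (x y : B.carrier), φ (B.op ω x y) = C.op ω (φ x) (φ y)

variable {B : OmegaAlgebra.{u, v, w} k Ω} {C : OmegaAlgebra.{u, v, s} k Ω}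
  {φ : B.carrier →ₗ[k] C.carrier}

theorem IsHom.map_evalMonomial (hφ : B.IsHom C φ) (x : ℕ → B.carrier) (s : OmegaMonomial Ω ℕ) :
    φ (B.evalMonomial x s) = C.evalMonomial (fun i => φ (x i)) s := by
  induction s with
  | var i => rfl
  | op ω s t hs ht => simp only [evalMonomial, hφ ω, hs, ht]

theorem IsHom.map_eval (hφ : B.IsHom C φ) (x : ℕ → B.carrier) (f : OmegaPolynomial k Ω) :
    φ (B.eval x f) = C.eval (fun i => φ (x i)) f := by
  simp only [eval, Finsupp.linearCombination_apply, Finsupp.sum, map_sum, map_smul,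
    hφ.map_evalMonomial]

theorem IsHom.satisfies_of_injective (hφ : B.IsHom C φ) (hinj : Function.Injective φ)
    {f : OmegaPolynomial k Ω} (hf : C.Satisfies f) : B.Satisfies f := fun x =>
  hinj (by rw [hφ.map_eval, hf, map_zero])

theorem IsHom.satisfies_of_surjective (hφ : B.IsHom C φ) (hsurj : Function.Surjective φ)
    {f : OmegaPolynomial k Ω} (hf : B.Satisfies f) : C.Satisfies f := fun x => by
  choose y hy using fun i => hsurj (x i)
  obtain rfl : (fun i => φ (y i)) = x := funext hy
  rw [← hφ.map_eval, hf, map_zero]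

/-! ### Extension of scalars -/

/-- The `Ω`-algebra `R ⊗ B` with `(r ⊗ a) ∘_ω (s ⊗ b) = rs ⊗ (a ∘_ω b)`. -/
def extendScalars (R : Type s) [CommRing R] [Algebra k R] (B : OmegaAlgebra.{u, v, w} k Ω) :
    OmegaAlgebra.{u, v, max w s} k Ω where
  carrier := R ⊗[k] B.carrier
  op ω := TensorProduct.map₂ (LinearMap.mul k R) (B.op ω)

theorem isHom_extendScalars_map {R : Type s} [CommRing R] [Algebra k R] {S : Type t} [CommRing S]
    [Algebra k S] (B : OmegaAlgebra.{u, v, w} k Ω) (g : R →ₐ[k] S) :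
    (B.extendScalars R).IsHom (B.extendScalars S)
      (TensorProduct.map g.toLinearMap LinearMap.id) := by
  exact fun ω => TensorProduct.map_op_of_tmul _ (((B.extendScalars S).op ω)) _ fun p q a b =>
    congrArg (· ⊗ₜ[k] B.op ω a b) (map_mul g p q)

theorem isHom_extendScalars_lid (B : OmegaAlgebra.{u, v, w} k Ω) :
    (B.extendScalars k).IsHom B (TensorProduct.lid k B.carrier).toLinearMap := by
  refine fun ω => TensorProduct.map_op_of_tmul _ (B.op ω) _ fun p q a b => ?_
  change (p * q) • B.op ω a b = B.op ω (p • a) (q • b)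
  rw [map_smul, map_smul, LinearMap.smul_apply, smul_smul, mul_comm]

end OmegaAlgebra

/-- Over an infinite field, a polynomial with vector coefficients that vanishes at all points is
zero. -/
theorem MvPolynomial.tmul_eq_zero_of_eval {k : Type u} [Field k] [Infinite k] {σ : Type v}
    {M : Type w} [AddCommGroup M] [Module k M] (u : MvPolynomial σ k ⊗[k] M)
    (hu : ∀ c : σ → k, TensorProduct.map (MvPolynomial.aeval (R := k) c).toLinearMap
      (LinearMap.id : M →ₗ[k] M) u = 0) : u = 0 := by
  classical
  -- Coordinates in a basis of `M` reduce the claim to scalar polynomials.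
  let b := Module.Basis.ofVectorSpace k M
  apply (TensorProduct.equivFinsuppOfBasisRight (M := MvPolynomial σ k) b).injective
  rw [map_zero]
  ext1 i
  apply MvPolynomial.funext
  intro c
  have key : ∀ u : MvPolynomial σ k ⊗[k] M,
      MvPolynomial.eval c (TensorProduct.equivFinsuppOfBasisRight b u i) =
        TensorProduct.equivFinsuppOfBasisRight b (TensorProduct.map
          (MvPolynomial.aeval (R := k) c).toLinearMap (LinearMap.id : M →ₗ[k] M) u) i := by
    intro u
    induction u using TensorProduct.induction_on with
    | zero => simp
    | add x y hx hy => simp only [map_add, Finsupp.add_apply, hx, hy]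
    | tmul p a =>
      simp [MvPolynomial.smul_eval, MvPolynomial.aeval_eq_eval]
  rw [key, hu]
  simp

namespace OmegaAlgebra

universe s

variable {k : Type u} [Field k] {Ω : Type v}

/-- Specialising the indeterminates to scalars is a homomorphism onto `B`, so the value of `f`
vanishes at every point and hence is zero. -/
theorem Satisfies.extendScalars_mvPolynomial [Infinite k] {B : OmegaAlgebra.{u, v, w} k Ω}
    {f : OmegaPolynomial k Ω} (hf : B.Satisfies f) (σ : Type s) :
    (B.extendScalars (MvPolynomial σ k)).Satisfies f := by
  intro x
  refine MvPolynomial.tmul_eq_zero_of_eval _ fun c => ?_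
  refine ((B.isHom_extendScalars_map (MvPolynomial.aeval c)).map_eval x f).trans ?_
  apply (TensorProduct.lid k B.carrier).injective
  have h := B.isHom_extendScalars_lid.map_eval (fun i => TensorProduct.map
    (MvPolynomial.aeval (R := k) c).toLinearMap (LinearMap.id : B.carrier →ₗ[k] B.carrier) (x i)) f
  rw [hf] at h
  rw [map_zero]
  exact h

/-- Over an infinite field, identities are preserved by commutative extensions of scalars. -/
theorem Satisfies.extendScalars [Infinite k] {B : OmegaAlgebra.{u, v, w} k Ω}
    {f : OmegaPolynomial k Ω} (hf : B.Satisfies f) (R : Type s) [CommRing R] [Algebra k R] :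
    (B.extendScalars R).Satisfies f := by
  -- Every commutative algebra `R` is a quotient of the polynomial ring on its own elements.
  refine (B.isHom_extendScalars_map
    (MvPolynomial.aeval (R := k) (id : R → R))).satisfies_of_surjective ?_
    (hf.extendScalars_mvPolynomial R)
  exact TensorProduct.map_surjective (fun r => ⟨MvPolynomial.X r, by simp⟩) Function.surjective_id

end OmegaAlgebra

/-! ### The products of `Â` and `Z ⊠ A` -/

namespace OmegaDialgebra

variable {k : Type u} [Field k] {Ω : Type v} {D : OmegaDialgebra.{u, v, w} k Ω}

theorem mkQ_left_eq_mkQ_right (ω : Ω) (a b : D.carrier) :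
    D.differenceSpan.mkQ (D.left ω a b) = D.differenceSpan.mkQ (D.right ω a b) :=
  (Submodule.Quotient.eq _).2 (Submodule.subset_span ⟨ω, a, b, rfl⟩)

/-- The projection `D → D̄`, as a map into the subalgebra `D̄` of `D̂`. -/
def toHatBar (D : OmegaDialgebra.{u, v, w} k Ω) (hD : D.IsDiAlg₀) :
    D.carrier →ₗ[k] (D.hat hD).carrier :=
  LinearMap.inl k (D.carrier ⧸ D.differenceSpan) D.carrier ∘ₗ D.differenceSpan.mkQ

/-- The inclusion of `D` as the square-zero ideal of `D̂`. -/
def toHatIdeal (D : OmegaDialgebra.{u, v, w} k Ω) (hD : D.IsDiAlg₀) :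
    D.carrier →ₗ[k] (D.hat hD).carrier :=
  LinearMap.inr k (D.carrier ⧸ D.differenceSpan) D.carrier

variable (hD : D.IsDiAlg₀)

theorem toHatBar_right (ω : Ω) (a b : D.carrier) :
    D.toHatBar hD (D.right ω a b) = D.toHatBar hD (D.left ω a b) := by
  exact congrArg (LinearMap.inl k (D.carrier ⧸ D.differenceSpan) D.carrier)
    (mkQ_left_eq_mkQ_right ω a b).symm

theorem hat_op_apply (ω : Ω) (x y : (D.hat hD).carrier) :
    (D.hat hD).op ω x y = ((D.bar hD).op ω x.1 y.1,
      D.barLeft hD ω x.1 y.2 + D.barRight hD ω x.2 y.1) := by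
  refine Prod.ext ?_ ?_
  · change _ + (0 : (D.bar hD).carrier) + (0 : (D.bar hD).carrier) = _
    rw [add_zero, add_zero]
    rfl
  · change (0 : D.carrier) + _ + _ = _
    rw [zero_add]
    rfl

theorem hat_op_bar_bar (ω : Ω) (a b : D.carrier) :
    (D.hat hD).op ω (D.toHatBar hD a) (D.toHatBar hD b) = D.toHatBar hD (D.left ω a b) := by
  rw [hat_op_apply]
  refine Prod.ext rfl ?_
  change D.barLeft hD ω _ 0 + D.barRight hD ω 0 _ = 0
  simp

theorem hat_op_bar_ideal (ω : Ω) (a b : D.carrier) :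
    (D.hat hD).op ω (D.toHatBar hD a) (D.toHatIdeal hD b) = D.toHatIdeal hD (D.left ω a b) := by
  rw [hat_op_apply]
  refine Prod.ext ?_ ?_
  · change (D.bar hD).op ω _ 0 = 0
    simp
  · change D.left ω a b + D.barRight hD ω 0 0 = D.left ω a b
    simp

theorem hat_op_ideal_bar (ω : Ω) (a b : D.carrier) :
    (D.hat hD).op ω (D.toHatIdeal hD a) (D.toHatBar hD b) = D.toHatIdeal hD (D.right ω a b) := by
  rw [hat_op_apply]
  refine Prod.ext ?_ ?_
  · change (D.bar hD).op ω 0 _ = 0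
    simp
  · change D.barLeft hD ω 0 0 + D.right ω a b = D.right ω a b
    simp

theorem hat_op_ideal_ideal (ω : Ω) (a b : D.carrier) :
    (D.hat hD).op ω (D.toHatIdeal hD a) (D.toHatIdeal hD b) = 0 := by
  rw [hat_op_apply]
  refine Prod.ext ?_ ?_
  · change (D.bar hD).op ω 0 0 = 0
    simp
  · change D.barLeft hD ω 0 b + D.barRight hD ω a 0 = 0
    simp

end OmegaDialgebra

universe s

theorem boxTimes_isHom_of_tmul {k : Type u} [Field k] {Ω : Type v} {Z : Type t} [AddCommGroup Z]
    [Module k Z] {p : Z →ₗ[k] Z →ₗ[k] Z} {D : OmegaDialgebra.{u, v, w} k Ω}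
    {C : OmegaAlgebra.{u, v, s} k Ω} (φ : Z ⊗[k] D.carrier →ₗ[k] C.carrier)
    (h : ∀ (ω : Ω) (z z' : Z) (a b : D.carrier),
      φ (p z z' ⊗ₜ D.left ω a b) + φ (p z' z ⊗ₜ D.right ω a b) =
        C.op ω (φ (z ⊗ₜ a)) (φ (z' ⊗ₜ b))) :
    (boxTimes p D).IsHom C φ := by
  exact fun ω => TensorProduct.map_op_of_tmul _ (C.op ω) φ fun z z' a b =>
    (map_add φ _ _).trans (h ω z z' a b)

/-! ### Zinbiel products -/

/-- The pre-commutative identity `(xy + yx)z = x(yz)`. -/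
class IsZinbiel {k : Type u} [Field k] {Z : Type w} [AddCommGroup Z] [Module k Z]
    (p : Z →ₗ[k] Z →ₗ[k] Z) : Prop where
  identity : ∀ x y z : Z, p (p x y + p y x) z = p x (p y z)

instance FreeZinbiel.isZinbiel (k : Type u) [Field k] (X : Type w) :
    IsZinbiel (FreeZinbiel.product k X) where
  identity x y z := by
    obtain ⟨x, rfl⟩ := Submodule.mkQ_surjective _ x
    obtain ⟨y, rfl⟩ := Submodule.mkQ_surjective _ y
    obtain ⟨z, rfl⟩ := Submodule.mkQ_surjective _ z
    exact (Submodule.Quotient.eq _).2 ((Submodule.mem_sInf).2 fun I hI => hI.1 x y z)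

section SplitExtension

variable {k : Type u} [Field k] {Z : Type w} [AddCommGroup Z] [Module k Z]

/-- For a Zinbiel product on `Z`, the space `Z ⊕ Z`, to be equipped with the product
`(x, m)(y, n) = (xy + yx, xn + ym)`. -/
def ZinbielExtension (_ : Z →ₗ[k] Z →ₗ[k] Z) : Type w := Z × Z

variable (p : Z →ₗ[k] Z →ₗ[k] Z)

instance : AddCommGroup (ZinbielExtension p) := inferInstanceAs (AddCommGroup (Z × Z))

instance : Module k (ZinbielExtension p) := inferInstanceAs (Module k (Z × Z))

instance : Mul (ZinbielExtension p) where
  mul x y := (p x.1 y.1 + p y.1 x.1, p x.1 y.2 + p y.1 x.2)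

namespace ZinbielExtension

variable {p}

theorem ext {x y : ZinbielExtension p} (h₁ : x.1 = y.1) (h₂ : x.2 = y.2) : x = y :=
  Prod.ext h₁ h₂

theorem mul_fst (x y : ZinbielExtension p) : (x * y).1 = p x.1 y.1 + p y.1 x.1 := rfl

theorem mul_snd (x y : ZinbielExtension p) : (x * y).2 = p x.1 y.2 + p y.1 x.2 := rfl

theorem add_fst (x y : ZinbielExtension p) : (x + y).1 = x.1 + y.1 := rfl

theorem add_snd (x y : ZinbielExtension p) : (x + y).2 = x.2 + y.2 := rfl

theorem smul_fst (c : k) (x : ZinbielExtension p) : (c • x).1 = c • x.1 := rfl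

theorem smul_snd (c : k) (x : ZinbielExtension p) : (c • x).2 = c • x.2 := rfl

theorem mul_comm' (x y : ZinbielExtension p) : x * y = y * x :=
  ext (add_comm _ _) (add_comm _ _)

theorem smul_mul' (c : k) (x y : ZinbielExtension p) : c • x * y = c • (x * y) := by
  apply ext <;> simp [mul_fst, mul_snd, smul_fst, smul_snd]

theorem add_mul' (x y z : ZinbielExtension p) : (x + y) * z = x * z + y * z := by
  apply ext <;> simp only [mul_fst, mul_snd, add_fst, add_snd, map_add, LinearMap.add_apply] <;> abel

theorem mul_assoc' [hp : IsZinbiel p] (x y z : ZinbielExtension p) :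
    x * y * z = x * (y * z) := by
  -- Left multiplications commute, since `(ab + ba)c` is symmetric in `a` and `b`.
  have comm : ∀ a b c : Z, p a (p b c) = p b (p a c) := fun a b c => by
    rw [← hp.identity, ← hp.identity, add_comm]
  apply ext
  · simp only [mul_fst, hp.identity]
    rw [map_add, map_add]
    rw [comm z.1 x.1 y.1, comm z.1 y.1 x.1]
    abel
  · simp only [mul_fst, mul_snd, hp.identity]
    rw [map_add, map_add]
    rw [comm z.1 x.1 y.2, comm z.1 y.1 x.2]
    abel

instance [IsZinbiel p] : NonUnitalCommRing (ZinbielExtension p) where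
  left_distrib x y z := by rw [mul_comm', add_mul', mul_comm' y, mul_comm' z]
  right_distrib := add_mul'
  zero_mul x := by simpa using smul_mul' (0 : k) (0 : ZinbielExtension p) x
  mul_zero x := by rw [mul_comm']; simpa using smul_mul' (0 : k) (0 : ZinbielExtension p) x
  mul_assoc := mul_assoc'
  mul_comm := mul_comm'

instance [IsZinbiel p] : IsScalarTower k (ZinbielExtension p) (ZinbielExtension p) where
  smul_assoc := smul_mul'

instance [IsZinbiel p] : SMulCommClass k (ZinbielExtension p) (ZinbielExtension p) where
  smul_comm c x y := by
    simp only [smul_eq_mul]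
    rw [mul_comm', mul_comm' x, smul_mul']

variable (p)

/-- The embedding of `Z` as the first summand. -/
def inl [IsZinbiel p] : Z →ₗ[k] Unitization k (ZinbielExtension p) :=
  Unitization.inrHom k k (ZinbielExtension p) ∘ₗ LinearMap.inl k Z Z

/-- The embedding of `Z` as the second summand. -/
def inr [IsZinbiel p] : Z →ₗ[k] Unitization k (ZinbielExtension p) :=
  Unitization.inrHom k k (ZinbielExtension p) ∘ₗ LinearMap.inr k Z Z

/-- The projection to the second summand. -/
def snd [IsZinbiel p] : Unitization k (ZinbielExtension p) →ₗ[k] Z :=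
  LinearMap.snd k Z Z ∘ₗ Unitization.sndHom k k (ZinbielExtension p)

variable [IsZinbiel p]

theorem inl_mul_inl (x y : Z) : inl p x * inl p y = inl p (p x y) + inl p (p y x) := by
  rw [← map_add]
  refine (Unitization.inr_mul k _ _).symm.trans (congrArg _ (ext rfl ?_))
  change p x 0 + p y 0 = 0
  simp

theorem inl_mul_inr (x y : Z) : inl p x * inr p y = inr p (p x y) := by
  refine (Unitization.inr_mul k _ _).symm.trans (congrArg _ (ext ?_ ?_))
  · change p x 0 + p 0 x = 0
    simp
  · change p x y + p 0 0 = p x y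
    simp

theorem inr_mul_inl (x y : Z) : inr p x * inl p y = inr p (p y x) := by
  rw [mul_comm, inl_mul_inr]

end ZinbielExtension

end SplitExtension

/-! ### Identities of `Â` hold on `Z ⊠ A` -/

section Embedding

variable {k : Type u} [Field k] {Ω : Type v} {Z : Type t} [AddCommGroup Z] [Module k Z]
  (p : Z →ₗ[k] Z →ₗ[k] Z) [IsZinbiel p] (D : OmegaDialgebra.{u, v, w} k Ω) (hD : D.IsDiAlg₀)

/-- The map `z ⊗ a ↦ (z, 0) ⊗ ā + (0, z) ⊗ a` from `Z ⊠ D` to an extension of scalars of `D̂`. -/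
def boxTimesEmbedding :
    Z ⊗[k] D.carrier →ₗ[k] Unitization k (ZinbielExtension p) ⊗[k] (D.hat hD).carrier :=
  TensorProduct.map (ZinbielExtension.inl p) (D.toHatBar hD) +
    TensorProduct.map (ZinbielExtension.inr p) (D.toHatIdeal hD)

theorem boxTimesEmbedding_tmul (z : Z) (a : D.carrier) :
    boxTimesEmbedding p D hD (z ⊗ₜ a) = ZinbielExtension.inl p z ⊗ₜ D.toHatBar hD a +
      ZinbielExtension.inr p z ⊗ₜ D.toHatIdeal hD a :=
  rfl

/-- Projecting both tensor factors to their second summands kills `(z, 0) ⊗ ā` and recovers `z ⊗ a`.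
-/
theorem boxTimesEmbedding_injective : Function.Injective (boxTimesEmbedding p D hD) := by
  have h : (TensorProduct.map (ZinbielExtension.snd p)
      (LinearMap.snd k (D.carrier ⧸ D.differenceSpan) D.carrier)) ∘ₗ boxTimesEmbedding p D hD =
      LinearMap.id := by
    refine TensorProduct.ext' fun z a => ?_
    refine (map_add (TensorProduct.map (ZinbielExtension.snd p)
      (LinearMap.snd k (D.carrier ⧸ D.differenceSpan) D.carrier))
      (ZinbielExtension.inl p z ⊗ₜ[k] D.toHatBar hD a)
      (ZinbielExtension.inr p z ⊗ₜ[k] D.toHatIdeal hD a)).trans ?_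
    change (0 : Z) ⊗ₜ[k] (0 : D.carrier) + z ⊗ₜ[k] a = z ⊗ₜ[k] a
    rw [TensorProduct.zero_tmul, zero_add]
  exact Function.LeftInverse.injective (LinearMap.congr_fun h)

theorem boxTimesEmbedding_isHom :
    (boxTimes p D).IsHom ((D.hat hD).extendScalars (Unitization k (ZinbielExtension p)))
      (boxTimesEmbedding p D hD) := by
  have key : ∀ (ω : Ω) (z z' : Z) (a b : D.carrier),
      boxTimesEmbedding p D hD (p z z' ⊗ₜ D.left ω a b) +
          boxTimesEmbedding p D hD (p z' z ⊗ₜ D.right ω a b) =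
        TensorProduct.map₂ (LinearMap.mul k (Unitization k (ZinbielExtension p)))
          ((D.hat hD).op ω) (boxTimesEmbedding p D hD (z ⊗ₜ a))
          (boxTimesEmbedding p D hD (z' ⊗ₜ b)) := by
    intro ω z z' a b
    -- The bar–bar term carries `zz' + z'z`, and it splits correctly because `⊢` and `⊣` agree in
    -- `D̄`. The mixed terms give `zz' ⊗ (a ⊢ b)` and `z'z ⊗ (a ⊣ b)`; the ideal–ideal term vanishes
    -- in `D̂`.
    simp only [boxTimesEmbedding_tmul, map_add, LinearMap.add_apply, TensorProduct.map₂_apply_tmul,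
      TensorProduct.map_tmul, LinearMap.mul_apply', D.hat_op_bar_bar, D.hat_op_bar_ideal,
      D.hat_op_ideal_bar, D.hat_op_ideal_ideal, ZinbielExtension.inl_mul_inl,
      ZinbielExtension.inl_mul_inr, ZinbielExtension.inr_mul_inl, D.toHatBar_right,
      TensorProduct.add_tmul, TensorProduct.tmul_zero]
    abel
  exact boxTimes_isHom_of_tmul (C := (D.hat hD).extendScalars _) (boxTimesEmbedding p D hD) key

theorem OmegaAlgebra.Satisfies.boxTimes_of_hat [Infinite k] {f : OmegaPolynomial k Ω}
    (hf : (D.hat hD).Satisfies f) : (boxTimes p D).Satisfies f :=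
  (boxTimesEmbedding_isHom p D hD).satisfies_of_injective (boxTimesEmbedding_injective p D hD)
    (hf.extendScalars _)

end Embedding

/-! ### Polynomials as a Zinbiel algebra -/

section Polynomials

variable (k : Type u) [Field k]

/-- The antiderivative without constant term. -/
def antiderivative : k[X] →ₗ[k] k[X] :=
  Polynomial.lsum fun n => (Polynomial.monomial (n + 1)) ∘ₗ LinearMap.lsmul k k ((n + 1 : k)⁻¹)

variable {k}

theorem antiderivative_monomial (n : ℕ) (c : k) :
    antiderivative k (monomial n c) = monomial (n + 1) ((n + 1 : k)⁻¹ * c) := by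
  simp [antiderivative, Polynomial.lsum_apply, Polynomial.sum_monomial_index]

/-- Integration by parts. -/
theorem antiderivative_mul_antiderivative [CharZero k] (f g : k[X]) :
    antiderivative k (antiderivative k f * g + antiderivative k g * f) =
      antiderivative k f * antiderivative k g := by
  induction f using Polynomial.induction_on' with
  | add f f' hf hf' => simp only [map_add, add_mul, mul_add, ← hf, ← hf']; abel
  | monomial i a =>
    induction g using Polynomial.induction_on' with
    | add g g' hg hg' => simp only [map_add, add_mul, mul_add, ← hg, ← hg']; abel
    | monomial j b =>
      simp only [antiderivative_monomial, Polynomial.monomial_mul_monomial, map_add]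
      rw [show j + 1 + i + 1 = i + 1 + (j + 1) by ring, show i + 1 + j + 1 = i + 1 + (j + 1) by ring,
        ← map_add]
      congr 1
      -- What remains is `(1/(i+1) + 1/(j+1)) / (i+j+2) = 1/((i+1)(j+1))`, with denominators
      -- invertible in characteristic zero.
      have hi : (i + 1 : k) ≠ 0 := Nat.cast_add_one_ne_zero i
      have hj : (j + 1 : k) ≠ 0 := Nat.cast_add_one_ne_zero j
      have hij : (i + 1 + j + 1 : k) ≠ 0 := by
        exact_mod_cast Nat.cast_add_one_ne_zero (R := k) (i + 1 + j)
      have hji : (j + 1 + i + 1 : k) ≠ 0 := by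
        exact_mod_cast Nat.cast_add_one_ne_zero (R := k) (j + 1 + i)
      push_cast
      field_simp
      ring

variable (k)

/-- The space `k[X]`, to be equipped with the Zinbiel product `f ⋆ g = (∫ f) g`. -/
def ZinbielPolynomial : Type u := k[X]

instance : AddCommGroup (ZinbielPolynomial k) := inferInstanceAs (AddCommGroup k[X])

instance : Module k (ZinbielPolynomial k) := inferInstanceAs (Module k k[X])

instance : Mul (ZinbielPolynomial k) where
  mul f g := (antiderivative k f * (show k[X] from g) : k[X])

namespace ZinbielPolynomial

/-- The underlying polynomial. -/
def toPoly : ZinbielPolynomial k →ₗ[k] k[X] := LinearMap.id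

variable {k}

theorem toPoly_injective : Function.Injective (toPoly k) := Function.injective_id

theorem toPoly_mul (f g : ZinbielPolynomial k) :
    toPoly k (f * g) = antiderivative k (toPoly k f) * toPoly k g := rfl

instance : NonUnitalNonAssocRing (ZinbielPolynomial k) where
  left_distrib f g h := toPoly_injective (by simp only [toPoly_mul, map_add, mul_add])
  right_distrib f g h := toPoly_injective (by simp only [toPoly_mul, map_add, add_mul])
  zero_mul f := toPoly_injective (by simp only [toPoly_mul, map_zero, zero_mul])
  mul_zero f := toPoly_injective (by simp only [toPoly_mul, map_zero, mul_zero])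

instance : IsScalarTower k (ZinbielPolynomial k) (ZinbielPolynomial k) where
  smul_assoc c f g := toPoly_injective (by
    simp only [smul_eq_mul, toPoly_mul, map_smul, smul_mul_assoc])

instance : SMulCommClass k (ZinbielPolynomial k) (ZinbielPolynomial k) where
  smul_comm c f g := toPoly_injective (by
    simp only [smul_eq_mul, toPoly_mul, map_smul, mul_smul_comm])

/-- With `F = ∫ f` and `G = ∫ g`, both sides equal `FGh`, because `∫ (Fg + Gf) = FG`. -/
theorem zinbiel_identity [CharZero k] (f g h : ZinbielPolynomial k) :
    (f * g + g * f) * h = f * (g * h) := by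
  apply toPoly_injective
  simp only [toPoly_mul, map_add (toPoly k), antiderivative_mul_antiderivative, mul_assoc]

end ZinbielPolynomial

variable [CharZero k] (X : Type w)

/-- The linear map `FreeZinbiel k X → k[X]` sending products to `f ⋆ g = (∫ f) g` and all
generators to `1`. -/
def FreeZinbiel.toPoly : FreeZinbiel k X →ₗ[k] k[X] :=
  ZinbielPolynomial.toPoly k ∘ₗ (zinbielIdeal k X).liftQ
    (FreeNonUnitalNonAssocAlgebra.lift k
      (fun _ : X => (show ZinbielPolynomial k from (1 : k[X]))) :
        FreeNonUnitalNonAssocAlgebra k X →ₗ[k] ZinbielPolynomial k)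
    -- The kernel is one of the ideals whose intersection is `zinbielIdeal`.
    (sInf_le ⟨fun x y z => by
        simp only [LinearMap.mem_ker]
        simp [ZinbielPolynomial.zinbiel_identity],
      fun x hx y => by
        simp only [LinearMap.mem_ker] at hx ⊢
        simp_all,
      fun x y hy => by
        simp only [LinearMap.mem_ker] at hy ⊢
        simp_all⟩)

variable {X}

theorem FreeZinbiel.toPoly_product (x y : FreeZinbiel k X) :
    FreeZinbiel.toPoly k X (FreeZinbiel.product k X x y) =
      antiderivative k (FreeZinbiel.toPoly k X x) * FreeZinbiel.toPoly k X y := by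
  obtain ⟨x, rfl⟩ := Submodule.mkQ_surjective _ x
  obtain ⟨y, rfl⟩ := Submodule.mkQ_surjective _ y
  exact congrArg (ZinbielPolynomial.toPoly k) (map_mul (FreeNonUnitalNonAssocAlgebra.lift k
      (fun _ : X => (show ZinbielPolynomial k from (1 : k[X])))) x y)

theorem FreeZinbiel.exists_toPoly_eq_one [Nonempty X] :
    ∃ z : FreeZinbiel k X, FreeZinbiel.toPoly k X z = 1 := by
  obtain ⟨i⟩ := ‹Nonempty X›
  exact ⟨Submodule.mkQ _ (FreeNonUnitalNonAssocAlgebra.of k i),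
    FreeNonUnitalNonAssocAlgebra.lift_of_apply k
      (fun _ : X => (show ZinbielPolynomial k from (1 : k[X]))) i⟩

end Polynomials

/-! ### Identities of `Z ⊠ A` hold on `Â` -/

section Projection

variable {k : Type u} [Field k] [CharZero k] {Ω : Type v} (X : Type t)
  (D : OmegaDialgebra.{u, v, w} k Ω) (hD : D.IsDiAlg₀)

/-- The map `z ⊗ a ↦ F(1) ā + F'(1) a`, where `F` is the antiderivative of the polynomial
assigned to `z`. -/
def boxTimesProjection : FreeZinbiel k X ⊗[k] D.carrier →ₗ[k] (D.hat hD).carrier :=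
  TensorProduct.lift
    ((LinearMap.lsmul k _).compl₁₂
        (Polynomial.leval 1 ∘ₗ antiderivative k ∘ₗ FreeZinbiel.toPoly k X) (D.toHatBar hD) +
      (LinearMap.lsmul k _).compl₁₂
        (Polynomial.leval 1 ∘ₗ FreeZinbiel.toPoly k X) (D.toHatIdeal hD))

theorem boxTimesProjection_tmul (z : FreeZinbiel k X) (a : D.carrier) :
    boxTimesProjection X D hD (z ⊗ₜ a) =
      (antiderivative k (FreeZinbiel.toPoly k X z)).eval 1 • D.toHatBar hD a +
        (FreeZinbiel.toPoly k X z).eval 1 • D.toHatIdeal hD a :=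
  rfl

/-- If `z, z'` give `f, g` with antiderivatives `F, G`, then `zz', z'z` give `Fg, Gf`. These are the
coefficients, at `1`, of `a ⊢ b` and `a ⊣ b` in the ideal. In `D̄` the two products coincide, and
the coefficients `∫ Fg` and `∫ Gf` add up to `FG`. -/
theorem boxTimesProjection_isHom :
    (boxTimes (FreeZinbiel.product k X) D).IsHom (D.hat hD) (boxTimesProjection X D hD) := by
  refine boxTimes_isHom_of_tmul (boxTimesProjection X D hD) fun ω z z' a b => ?_
  have key := congrArg (Polynomial.eval 1) (antiderivative_mul_antiderivative
    (FreeZinbiel.toPoly k X z) (FreeZinbiel.toPoly k X z'))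
  simp only [map_add, Polynomial.eval_add, Polynomial.eval_mul] at key
  simp only [boxTimesProjection_tmul, FreeZinbiel.toPoly_product, map_add, map_smul,
    LinearMap.add_apply, LinearMap.smul_apply, D.hat_op_bar_bar, D.hat_op_bar_ideal,
    D.hat_op_ideal_bar, D.hat_op_ideal_ideal, D.toHatBar_right, smul_zero, add_zero, smul_smul,
    Polynomial.eval_mul, smul_add]
  rw [add_add_add_comm, ← add_smul, key]
  module

theorem boxTimesProjection_surjective [Nonempty X] :
    Function.Surjective (boxTimesProjection X D hD) := by
  obtain ⟨z, hz⟩ := FreeZinbiel.exists_toPoly_eq_one k (X := X)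
  have h1 : antiderivative k 1 = Polynomial.X := by
    simpa [Polynomial.monomial_one_one_eq_X] using antiderivative_monomial 0 (1 : k)
  have hX : (antiderivative k Polynomial.X).eval 1 = 2⁻¹ := by
    rw [← Polynomial.monomial_one_one_eq_X, antiderivative_monomial]
    norm_num
  have hzz : FreeZinbiel.toPoly k X (FreeZinbiel.product k X z z) = Polynomial.X := by
    rw [FreeZinbiel.toPoly_product, hz, h1, mul_one]
  rintro ⟨a, b⟩
  obtain ⟨a, rfl⟩ := Submodule.mkQ_surjective _ a
  have hab : ((D.differenceSpan.mkQ a, b) : (D.hat hD).carrier) =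
      D.toHatBar hD a + D.toHatIdeal hD b :=
    Prod.ext (add_zero _).symm (zero_add _).symm
  -- The polynomials are `2 - 2X` and `2X - 1`, with antiderivatives `2X - X²` and `X² - X`; so
  -- `(F(1), f(1))` is `(1, 0)` and `(0, 1)`.
  refine ⟨(2 • z - 2 • FreeZinbiel.product k X z z) ⊗ₜ a +
    (2 • FreeZinbiel.product k X z z - z) ⊗ₜ b, ?_⟩
  rw [map_add, boxTimesProjection_tmul, boxTimesProjection_tmul]
  simp only [map_sub, map_nsmul, hz, hzz, h1, Polynomial.eval_sub, Polynomial.eval_smul, hX,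
    Polynomial.eval_X, Polynomial.eval_one]
  refine Eq.trans ?_ hab.symm
  norm_num

theorem OmegaAlgebra.Satisfies.hat_of_boxTimes [Nonempty X] {f : OmegaPolynomial k Ω}
    (hf : (boxTimes (FreeZinbiel.product k X) D).Satisfies f) : (D.hat hD).Satisfies f :=
  (boxTimesProjection_isHom X D hD).satisfies_of_surjective
    (boxTimesProjection_surjective X D hD) hf

end Projection

end

theorem theorem3 {k : Type u} [Field k] [CharZero k] {Ω : Type v}
    (A : OmegaDialgebra.{u, v, w} k Ω) (hA : A.IsDiAlg₀) (m : ℕ) (hm : 1 ≤ m) :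
    (boxTimes (FreeZinbiel.product k (Fin m)) A).Var =
      ((A.hat hA).Var : Set (OmegaAlgebra.{u, v, t} k Ω)) := by
  have : Nonempty (Fin m) := ⟨⟨0, hm⟩⟩
  refine Set.Subset.antisymm (fun C hC f hf => hC f ?_) (fun C hC f hf => hC f ?_)
  · exact hf.boxTimes_of_hat (FreeZinbiel.product k (Fin m)) A hA
  · exact hf.hat_of_boxTimes (Fin m) A hA
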